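/- Let $\mathbb{U}$ be a standard universe (a universe of sets, possibly over individuals, closed under pairs, unions and full power sets, such as a superstructure $V(X)$ or the universe of all sets), and let ${}^*\mathbb{U}$ be an elementary extension of $(\mathbb{U},\in)$ that is sufficiently saturated: every family of internal sets that is indexed by a standard set (an element of $\mathbb{U}$) and has the finite intersection property has a nonempty intersection. Here a subset of ${}^*\mathbb{U}$ is internal if it is the set of all elements, in the sense of ${}^*\mathbb{U}$, of some object of ${}^*\mathbb{U}$. A subset of ${}^*\mathbb{U}$ is *galactic* (resp. *halic*) if it is the union $\bigcup_{i\in S}A_i$ (resp. the intersection $\bigcap_{i\in S}A_i$) of a family, not necessarily internal, of internal sets $A_i$ indexed by a standard set $S$. Let $(\Delta,\le)\in\mathbb{U}$ be a directed set. An element $\delta\in{}^*\Delta$ is *limited* if $\delta\le d$ for some $d\in\Delta$, and *illimited* if $d\le\delta$ for all $d\in\Delta$. A set $A\subseteq{}^*\Delta$ is said to contain - all sufficiently large limited elements, if there is a limited $L$ such that every limited $\delta\ge L$ is in $A$; - arbitrarily large limited elements, if for every limited $L$ there is a limited $\delta\ge L$ in $A$; - all sufficiently small illimited elements, if there is an illimited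 $U$ such that every illimited $\delta\le U$ is in $A$; - arbitrarily small illimited elements, if for every illimited $U$ there is an illimited $\delta\le U$ in $A$. **Halic overspill.** Let $H\subseteq{}^*\Delta$ be halic. (1) If $H$ contains all sufficiently large limited elements of ${}^*\Delta$, then it contains all sufficiently small illimited elements of ${}^*\Delta$. (2) If $H$ contains arbitrarily large limited elements of ${}^*\Delta$, then it contains arbitrarily small illimited elements of ${}^*\Delta$. **Galactic underspill.** Let $G\subseteq{}^*\Delta$ be galactic. (1) If $G$ contains all sufficiently small illimited elements of ${}^*\Delta$, then it contains all sufficiently large limited elements of ${}^*\Delta$. (2) If $G$ contains arbitrarily small illimited elements of ${}^*\Delta$, then it contains arbitrarily large limited elements of ${}^*\Delta$. -/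

import Mathlib

namespace Nonstandard

/-- The only symbol of the language of set theory: the binary relation of membership. -/
inductive SetRel : ℕ → Type
  | mem : SetRel 2

/-- The first-order language of set theory. -/
def setLang : FirstOrder.Language.{0, 0} := ⟨fun _ => Empty, SetRel⟩

section Basic

variable {M : Type*} [setLang.Structure M]

/-- `El x a`: in the structure `M`, the object `x` is an element of `a`. -/
def El (x a : M) : Prop :=
  FirstOrder.Language.Structure.RelMap (L := setLang) (SetRel.mem : SetRel 2) ![x, a]

/-- In `M`, the object `z` is the unordered pair `{x, y}`. -/
def IsPair (z x y : M) : Prop := ∀ w, El w z ↔ w = x ∨ w = y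

/-- In `M`, the object `p` is the (Kuratowski) ordered pair `(x, y) = {{x}, {x, y}}`. -/
def IsOrdPair (p x y : M) : Prop := ∀ z, El z p ↔ IsPair z x x ∨ IsPair z x y

/-- In `M`, the binary relation `R` (a set of ordered pairs) holds between `x` and `y`. -/
def Rel (R x y : M) : Prop := ∃ p, El p R ∧ IsOrdPair p x y

/-- `D`, with the relation `R` on it, is a directed set: `R` is reflexive and transitive on `D`,
and any two elements of `D` have an upper bound in `D`.  (The empty set is not excluded.) -/
structure IsDirectedSet (D R : M) : Prop where
  rel_on : ∀ p, El p R → ∃ x y, El x D ∧ El y D ∧ IsOrdPair p x y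
  refl : ∀ x, El x D → Rel R x x
  trans : ∀ x y z, El x D → El y D → El z D → Rel R x y → Rel R y z → Rel R x z
  directed : ∀ x y, El x D → El y D → ∃ z, El z D ∧ Rel R x z ∧ Rel R y z

/-- A subset of `M` is internal if it is the set of all elements of some object of `M`. -/
def IsInternal (A : Set M) : Prop := ∃ a : M, A = {x | El x a}

end Basic

/-- A standard universe: a universe of sets, possibly over individuals (objects without elements),
closed under unordered pairs, unions and full power sets.  Examples are the superstructures `V(X)`,
the levels `V_λ` of the cumulative hierarchy at limit ordinals `λ > 0`, Grothendieck universes and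
the universe of all sets.  The quantification over `T : Set U` says that
*every* subset of a set of the universe is again a set of the universe. Extensionality is required
of nonempty sets only, as individuals have the same elements as the empty set. -/
structure IsStandardUniverse (U : Type*) [setLang.Structure U] : Prop where
  ext : ∀ a b : U, (∃ x, El x a) → (∀ x, El x a ↔ El x b) → a = b
  pair : ∀ x y : U, ∃ z, IsPair z x y
  union : ∀ a : U, ∃ b, ∀ x, El x b ↔ ∃ y, El y a ∧ El x y
  power : ∀ a : U, ∃ b, (∀ x, El x b → ∀ w, El w x → El w a) ∧
    ∀ T : Set U, (∀ w ∈ T, El w a) → ∃ x, El x b ∧ ∀ w, El w x ↔ w ∈ T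

section Extension

variable (U : Type*) {M : Type*} [setLang.Structure U] [setLang.Structure M]

variable (M) in
/-- Saturation: every family of internal sets that is indexed by a standard set and has the finite
intersection property has a nonempty intersection.  The family itself need not be internal. -/
def IsSaturated : Prop :=
  ∀ (S : U) (F : {i : U // El i S} → Set M), (∀ i, IsInternal (F i)) →
    (∀ t : Finset {i : U // El i S}, (⋂ i ∈ t, F i).Nonempty) → (⋂ i, F i).Nonempty

/-- A galactic set: a union of internal sets, indexed by a standard set. -/
def IsGalactic (G : Set M) : Prop :=
  ∃ (S : U) (F : {i : U // El i S} → Set M), (∀ i, IsInternal (F i)) ∧ G = ⋃ i, F i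

/-- A halic set: an intersection of internal sets, indexed by a standard set. -/
def IsHalic (H : Set M) : Prop :=
  ∃ (S : U) (F : {i : U // El i S} → Set M), (∀ i, IsInternal (F i)) ∧ H = ⋂ i, F i

end Extension

section Directed

variable {U M : Type*} [setLang.Structure U] [setLang.Structure M]
  (star : FirstOrder.Language.ElementaryEmbedding setLang U M) (D R : U)

/-- The set `*D` of the elements of the nonstandard extension of `D`. -/
def starSet : Set M := {x | El x (star D)}

/-- The order of `*D`, the nonstandard extension of the order `R` of `D`. -/
def starLE (x y : M) : Prop := Rel (star R) x y

/-- `δ ∈ *D` is limited if it is dominated by some element of `D`. -/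
def IsLimited (δ : M) : Prop :=
  δ ∈ starSet star D ∧ ∃ d : U, El d D ∧ starLE star R δ (star d)

/-- `δ ∈ *D` is illimited if it dominates every element of `D`. -/
def IsIllimited (δ : M) : Prop :=
  δ ∈ starSet star D ∧ ∀ d : U, El d D → starLE star R (star d) δ

/-- `A` contains all sufficiently large limited elements of `*D`. -/
def ContainsAllLargeLimited (A : Set M) : Prop :=
  ∃ l, IsLimited star D R l ∧ ∀ δ, IsLimited star D R δ → starLE star R l δ → δ ∈ A

/-- `A` contains arbitrarily large limited elements of `*D`. -/
def ContainsArbitrarilyLargeLimited (A : Set M) : Prop :=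
  ∀ l, IsLimited star D R l → ∃ δ, IsLimited star D R δ ∧ starLE star R l δ ∧ δ ∈ A

/-- `A` contains all sufficiently small illimited elements of `*D`. -/
def ContainsAllSmallIllimited (A : Set M) : Prop :=
  ∃ u, IsIllimited star D R u ∧ ∀ δ, IsIllimited star D R δ → starLE star R δ u → δ ∈ A

/-- `A` contains arbitrarily small illimited elements of `*D`. -/
def ContainsArbitrarilySmallIllimited (A : Set M) : Prop :=
  ∀ u, IsIllimited star D R u → ∃ δ, IsIllimited star D R δ ∧ starLE star R δ u ∧ δ ∈ A

end Directed

end Nonstandard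

/-! Overspill is one application of saturation. Let the halic set be the trace on `*D` of an
intersection of internal sets `A i`. If it contains all limited elements above a standard `d₀`, then
the sets `{u | [d₀, u] ⊆ A i}` and `{u | d ≤ u}`, for `d` in `D`, have the finite intersection
property: a standard upper bound of `d₀` and of finitely many `d` serves as a witness, since
everything below it is limited. A common point is the required illimited bound. If it only contains
arbitrarily large limited elements, the sets `A i` and `[d, u]`, for a given illimited `u`, play the
same role.

Underspill follows by contraposition: complements in `*D` exchange galactic and halic sets, and
negation exchanges "all" with "arbitrarily".

The sets involved are internal because separation, which full power sets provide in `U`, transfers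
formula by formula (`isInternal_sep`). -/

namespace Nonstandard

open FirstOrder FirstOrder.Language

/-! ### Formulas for the set-theoretic notions to be transferred -/

section Formulas

variable {M : Type*} [setLang.Structure M] {n : ℕ}

/-- The formula `x_i ∈ x_j`. -/
def elFormula (i j : Fin n) : setLang.BoundedFormula Empty n :=
  Relations.boundedFormula₂ (L := setLang) (SetRel.mem : SetRel 2)
    (Term.var (Sum.inr i)) (Term.var (Sum.inr j))

/-- The formula `x_i = x_j`. -/
def eqFormula (i j : Fin n) : setLang.BoundedFormula Empty n :=
  Term.bdEqual (Term.var (Sum.inr i)) (Term.var (Sum.inr j))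

/-- The formula `x_z = {x_i, x_j}`. -/
def pairFormula (z i j : Fin n) : setLang.BoundedFormula Empty n :=
  ((elFormula (Fin.last n) z.castSucc).iff
    (eqFormula (Fin.last n) i.castSucc ⊔ eqFormula (Fin.last n) j.castSucc)).all

/-- The formula `x_p = (x_i, x_j)`. -/
def ordPairFormula (p i j : Fin n) : setLang.BoundedFormula Empty n :=
  ((elFormula (Fin.last n) p.castSucc).iff
    (pairFormula (Fin.last n) i.castSucc i.castSucc ⊔
      pairFormula (Fin.last n) i.castSucc j.castSucc)).all

/-- The formula `(x_i, x_j) ∈ x_r`. -/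
def relFormula (r i j : Fin n) : setLang.BoundedFormula Empty n :=
  (elFormula (Fin.last n) r.castSucc ⊓ ordPairFormula (Fin.last n) i.castSucc j.castSucc).ex

variable {v : Empty → M} {xs : Fin n → M}

@[simp]
theorem realize_elFormula {i j : Fin n} :
    (elFormula i j).Realize v xs ↔ El (xs i) (xs j) := by
  exact BoundedFormula.realize_rel₂

@[simp]
theorem realize_eqFormula {i j : Fin n} : (eqFormula i j).Realize v xs ↔ xs i = xs j := by
  simp [eqFormula]

@[simp]
theorem realize_pairFormula {z i j : Fin n} :
    (pairFormula z i j).Realize v xs ↔ IsPair (xs z) (xs i) (xs j) := by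
  simp [pairFormula, IsPair]

@[simp]
theorem realize_ordPairFormula {p i j : Fin n} :
    (ordPairFormula p i j).Realize v xs ↔ IsOrdPair (xs p) (xs i) (xs j) := by
  simp [ordPairFormula, IsOrdPair]

@[simp]
theorem realize_relFormula {r i j : Fin n} :
    (relFormula r i j).Realize v xs ↔ Rel (xs r) (xs i) (xs j) := by
  simp [relFormula, Rel]

end Formulas

/-! ### Separation, unions and finite upper bounds in the standard universe -/

section Universe

variable {U : Type*} [setLang.Structure U]

/-- The power set is full, so `P` may be any predicate, definable or not. -/
theorem IsStandardUniverse.exists_sep (hU : IsStandardUniverse U) (a : U) (P : U → Prop) :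
    ∃ b, ∀ x, El x b ↔ El x a ∧ P x := by
  obtain ⟨c, -, hc⟩ := hU.power a
  obtain ⟨b, -, hb⟩ := hc {x | El x a ∧ P x} fun _ hw => hw.1
  exact ⟨b, hb⟩

theorem IsStandardUniverse.exists_union (hU : IsStandardUniverse U) (a b : U) :
    ∃ c, ∀ x, El x c ↔ El x a ∨ El x b := by
  obtain ⟨p, hp⟩ := hU.pair a b
  obtain ⟨c, hc⟩ := hU.union p
  refine ⟨c, fun x => ?_⟩
  rw [hc]
  constructor
  · rintro ⟨y, hy, hx⟩
    rcases (hp y).1 hy with rfl | rfl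
    exacts [Or.inl hx, Or.inr hx]
  · rintro (hx | hx)
    exacts [⟨a, (hp a).2 (Or.inl rfl), hx⟩, ⟨b, (hp b).2 (Or.inr rfl), hx⟩]

/-- The base point `d₀` handles the empty finset, as a directed set may be empty here. -/
theorem IsDirectedSet.exists_upper_bound {D R : U} (hD : IsDirectedSet D R) {d₀ : U}
    (hd₀ : El d₀ D) (s : Finset {d : U // El d D}) :
    ∃ e, El e D ∧ Rel R d₀ e ∧ ∀ d ∈ s, Rel R d e := by
  classical
  induction s using Finset.induction_on with
  | empty => exact ⟨d₀, hd₀, hD.refl d₀ hd₀, by simp⟩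
  | insert a s _ ih =>
    obtain ⟨e, he, h₀, hs⟩ := ih
    obtain ⟨f, hf, hef, haf⟩ := hD.directed e a he a.2
    refine ⟨f, hf, hD.trans _ _ _ hd₀ he hf h₀ hef, fun d hd => ?_⟩
    rcases Finset.mem_insert.1 hd with rfl | hd
    exacts [haf, hD.trans _ _ _ d.2 he hf (hs d hd) hef]

end Universe

/-! ### Transfer and the internal definition principle -/

section Transfer

variable {U M : Type*} [setLang.Structure U] [setLang.Structure M]
  (star : setLang.ElementaryEmbedding U M)

theorem el_star_iff {x a : U} : El (star x) (star a) ↔ El x a := by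
  have h := star.map_boundedFormula (elFormula (0 : Fin 2) 1) Empty.elim ![x, a]
  rw [realize_elFormula, realize_elFormula] at h
  exact h

theorem rel_star_iff {r x y : U} : Rel (star r) (star x) (star y) ↔ Rel r x y := by
  have h := star.map_boundedFormula (relFormula (0 : Fin 3) 1 2) Empty.elim ![r, x, y]
  rw [realize_relFormula, realize_relFormula] at h
  exact h

theorem exists_el_of_el_star {a : U} {x : M} (hx : El x (star a)) : ∃ y, El y a := by
  have h := star.map_boundedFormula (elFormula (1 : Fin 2) 0).ex Empty.elim ![a]
  simp only [BoundedFormula.realize_ex, realize_elFormula] at h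
  exact h.1 ⟨x, hx⟩

theorem IsDirectedSet.rel_star_trans {D R : U} (hD : IsDirectedSet D R) {x y z : M}
    (hx : El x (star D)) (hy : El y (star D)) (hz : El z (star D))
    (hxy : Rel (star R) x y) (hyz : Rel (star R) y z) : Rel (star R) x z := by
  have h := star.map_boundedFormula
    ((elFormula (2 : Fin 5) 0).imp ((elFormula 3 0).imp ((elFormula 4 0).imp
      ((relFormula 1 2 3).imp ((relFormula 1 3 4).imp (relFormula 1 2 4)))))).all.all.all
    Empty.elim ![D, R]
  simp only [BoundedFormula.realize_all, BoundedFormula.realize_imp, realize_elFormula,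
    realize_relFormula] at h
  exact h.2 hD.trans x y z hx hy hz hxy hyz

/-- The instance of the axiom of separation for the formula `φ`, whose last variable is the
element and whose other variables are parameters; the ambient set is the parameter `c`. -/
def sepFormula {n : ℕ} (φ : setLang.BoundedFormula Empty (n + 1)) (c : Fin n) :
    setLang.BoundedFormula Empty n :=
  ((elFormula (Fin.last (n + 1)) (Fin.last n).castSucc).iff
    (elFormula (Fin.last (n + 1)) c.castSucc.castSucc ⊓ φ.liftAt 1 n)).all.ex

theorem realize_sepFormula {N : Type*} [setLang.Structure N] {n : ℕ}
    {φ : setLang.BoundedFormula Empty (n + 1)} {c : Fin n} {v : Empty → N} {p : Fin n → N} :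
    (sepFormula φ c).Realize v p ↔
      ∃ b, ∀ x, El x b ↔ El x (p c) ∧ φ.Realize v (Fin.snoc p x) := by
  -- The separated set `b` occupies index `n`, so lifting moves the element variable of `φ` from `n`
  -- to `n + 1` and `φ` does not see `b`.
  have key : ∀ b x : N, (Fin.snoc (Fin.snoc p b : Fin (n + 1) → N) x : Fin (n + 2) → N) ∘
      (fun i : Fin (n + 1) => if (i : ℕ) < n then i.castSucc else i.succ) = Fin.snoc p x := by
    intro b x
    funext i
    induction i using Fin.lastCases with
    | last => simp
    | cast i => simp
  simp only [sepFormula, BoundedFormula.realize_ex, BoundedFormula.realize_all,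
    BoundedFormula.realize_iff, BoundedFormula.realize_inf, realize_elFormula,
    BoundedFormula.realize_liftAt_one (Nat.le_succ n), key, Fin.snoc_last, Fin.snoc_castSucc]

/-- The internal definition principle. -/
theorem IsStandardUniverse.isInternal_sep (hU : IsStandardUniverse U)
    (star : setLang.ElementaryEmbedding U M) {n : ℕ}
    (φ : setLang.BoundedFormula Empty (n + 1)) (p : Fin n → M) (c : Fin n) :
    IsInternal {x | El x (p c) ∧ φ.Realize Empty.elim (Fin.snoc p x)} := by
  -- Closing universally over the parameters gives a sentence, so its transfer applies to arbitrary
  -- parameters in `M`, not only to standard ones.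
  have h := star.map_formula (sepFormula φ c).alls Empty.elim
  rw [BoundedFormula.realize_alls, BoundedFormula.realize_alls] at h
  have h' := h.2 fun q => realize_sepFormula.2 (hU.exists_sep _ _)
  obtain ⟨b, hb⟩ := realize_sepFormula.1 (h' p)
  refine ⟨b, Set.ext fun x => ?_⟩
  rw [Subsingleton.elim (Empty.elim : Empty → M) (star ∘ Empty.elim)]
  exact (hb x).symm

theorem IsStandardUniverse.isInternal_inter (hU : IsStandardUniverse U)
    (star : setLang.ElementaryEmbedding U M) {A B : Set M} (hA : IsInternal A)
    (hB : IsInternal B) : IsInternal (A ∩ B) := by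
  obtain ⟨a, rfl⟩ := hA
  obtain ⟨b, rfl⟩ := hB
  have h := hU.isInternal_sep star (elFormula (2 : Fin 3) 1) ![a, b] 0
  simp only [realize_elFormula] at h
  exact h

theorem IsStandardUniverse.isInternal_diff (hU : IsStandardUniverse U)
    (star : setLang.ElementaryEmbedding U M) {A B : Set M} (hA : IsInternal A)
    (hB : IsInternal B) : IsInternal (A \ B) := by
  obtain ⟨a, rfl⟩ := hA
  obtain ⟨b, rfl⟩ := hB
  have h := hU.isInternal_sep star (elFormula (2 : Fin 3) 1).not ![a, b] 0
  simp only [BoundedFormula.realize_not, realize_elFormula] at h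
  exact h

theorem IsStandardUniverse.isInternal_Ici (hU : IsStandardUniverse U)
    (star : setLang.ElementaryEmbedding U M) (a r d : M) :
    IsInternal {x | El x a ∧ Rel r d x} := by
  have h := hU.isInternal_sep star (relFormula (1 : Fin 4) 2 3) ![a, r, d] 0
  simp only [realize_relFormula] at h
  exact h

theorem IsStandardUniverse.isInternal_Iic (hU : IsStandardUniverse U)
    (star : setLang.ElementaryEmbedding U M) (a r u : M) :
    IsInternal {x | El x a ∧ Rel r x u} := by
  have h := hU.isInternal_sep star (relFormula (1 : Fin 4) 3 2) ![a, r, u] 0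
  simp only [realize_relFormula] at h
  exact h

theorem IsStandardUniverse.isInternal_Icc_subset (hU : IsStandardUniverse U)
    (star : setLang.ElementaryEmbedding U M) (a r d : M) {B : Set M} (hB : IsInternal B) :
    IsInternal {u | El u a ∧ ∀ x, El x a → Rel r d x → Rel r x u → x ∈ B} := by
  obtain ⟨b, rfl⟩ := hB
  have h := hU.isInternal_sep star
    ((elFormula (5 : Fin 6) 0).imp ((relFormula 1 3 5).imp ((relFormula 1 5 4).imp
      (elFormula 5 2)))).all ![a, r, b, d] 0
  simp only [BoundedFormula.realize_all, BoundedFormula.realize_imp, realize_elFormula,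
    realize_relFormula] at h
  exact h

end Transfer

/-! ### Saturation arguments and passage to complements -/

section Overspill

variable {U M : Type*} [setLang.Structure U] [setLang.Structure M]
  {star : setLang.ElementaryEmbedding U M} {D R : U}

/-- Saturation for two families of internal sets, indexed by two standard sets. -/
theorem IsSaturated.exists_mem_of_two_families (hU : IsStandardUniverse U)
    (star : setLang.ElementaryEmbedding U M) (hsat : IsSaturated U M) {S D : U}
    {A : {i : U // El i S} → Set M} {C : {d : U // El d D} → Set M}
    (hA : ∀ i, IsInternal (A i)) (hC : ∀ d, IsInternal (C d))
    (hfip : ∀ s : Finset {d : U // El d D}, ∃ x, (∀ i, x ∈ A i) ∧ ∀ d ∈ s, x ∈ C d) :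
    ∃ x, (∀ i, x ∈ A i) ∧ ∀ d, x ∈ C d := by
  classical
  obtain ⟨T, hT⟩ := hU.exists_union S D
  -- `S` and `D` may overlap: an index in both carries both conditions, and a condition whose index
  -- is missing is vacuous.
  let F : {j : U // El j T} → Set M := fun j =>
    {x | (∀ h : El j.1 S, x ∈ A ⟨j, h⟩) ∧ ∀ h : El j.1 D, x ∈ C ⟨j, h⟩}
  have hF : ∀ j, IsInternal (F j) := by
    rintro ⟨j, hj⟩
    by_cases hS : El j S <;> by_cases hD : El j D
    · rw [show F ⟨j, hj⟩ = A ⟨j, hS⟩ ∩ C ⟨j, hD⟩ from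
        Set.ext fun x => and_congr (forall_prop_of_true hS) (forall_prop_of_true hD)]
      exact hU.isInternal_inter star (hA _) (hC _)
    · simpa [F, hS, hD] using hA ⟨j, hS⟩
    · simpa [F, hS, hD] using hC ⟨j, hD⟩
    · exact absurd ((hT j).1 hj) (by tauto)
  obtain ⟨x, hx⟩ := hsat T F hF fun t => by
    obtain ⟨x, hxA, hxC⟩ := hfip ((t.image Subtype.val).subtype fun d => El d D)
    refine ⟨x, Set.mem_iInter₂.2 fun j hj => ⟨fun h => hxA _, fun h => hxC _ ?_⟩⟩
    exact Finset.mem_subtype.2 (Finset.mem_image_of_mem _ hj)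
  rw [Set.mem_iInter] at hx
  exact ⟨x, fun i => (hx ⟨i, (hT i).2 (Or.inl i.2)⟩).1 i.2,
    fun d => (hx ⟨d, (hT d).2 (Or.inr d.2)⟩).2 d.2⟩

theorem IsDirectedSet.isLimited_star (hD : IsDirectedSet D R) {d : U} (hd : El d D) :
    IsLimited star D R (star d) :=
  ⟨(el_star_iff star).2 hd, d, hd, (rel_star_iff star).2 (hD.refl d hd)⟩

/-- Halic overspill, for all sufficiently large elements. -/
theorem containsAllSmallIllimited_of_halic (hU : IsStandardUniverse U) (hsat : IsSaturated U M)
    (hD : IsDirectedSet D R) {S : U} {A : {i : U // El i S} → Set M}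
    (hA : ∀ i, IsInternal (A i))
    (h : ContainsAllLargeLimited star D R (starSet star D ∩ ⋂ i, A i)) :
    ContainsAllSmallIllimited star D R (starSet star D ∩ ⋂ i, A i) := by
  obtain ⟨l, ⟨hl, d₀, hd₀, hld₀⟩, hA'⟩ := h
  have hd₀' := (el_star_iff star).2 hd₀
  obtain ⟨u, huA, huC⟩ := hsat.exists_mem_of_two_families hU star
    (fun i => hU.isInternal_Icc_subset star (star D) (star R) (star d₀) (hA i))
    (fun d : {d : U // El d D} => hU.isInternal_Ici star (star D) (star R) (star d)) (by
      intro s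
      obtain ⟨e, he, h₀, hs⟩ := hD.exists_upper_bound hd₀ s
      have he' := (el_star_iff star).2 he
      refine ⟨star e, fun i => ⟨he', fun x hx h₁ h₂ => ?_⟩,
        fun d hd => ⟨he', (rel_star_iff star).2 (hs d hd)⟩⟩
      -- `x ≤ e` makes `x` limited, and `l ≤ d₀ ≤ x`.
      exact Set.mem_iInter.1 (hA' x ⟨hx, e, he, h₂⟩
        (hD.rel_star_trans star hl hd₀' hx hld₀ h₁)).2 i)
  refine ⟨u, ⟨(huC ⟨d₀, hd₀⟩).1, fun d hd => (huC ⟨d, hd⟩).2⟩, fun δ hδ hδu => ⟨hδ.1, ?_⟩⟩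
  exact Set.mem_iInter.2 fun i => (huA i).2 δ hδ.1 (hδ.2 d₀ hd₀) hδu

/-- Halic overspill, for arbitrarily large elements. -/
theorem containsArbitrarilySmallIllimited_of_halic (hU : IsStandardUniverse U)
    (hsat : IsSaturated U M) (hD : IsDirectedSet D R) {S : U} {A : {i : U // El i S} → Set M}
    (hA : ∀ i, IsInternal (A i))
    (h : ContainsArbitrarilyLargeLimited star D R (starSet star D ∩ ⋂ i, A i)) :
    ContainsArbitrarilySmallIllimited star D R (starSet star D ∩ ⋂ i, A i) := by
  rintro u ⟨hu, hDu⟩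
  -- An illimited element exists, so `*D`, and by transfer `D`, is nonempty.
  obtain ⟨d₀, hd₀⟩ := exists_el_of_el_star star hu
  obtain ⟨x, hxA, hxC⟩ := hsat.exists_mem_of_two_families hU star hA
    (fun d : {d : U // El d D} => hU.isInternal_inter star
      (hU.isInternal_Ici star (star D) (star R) (star d))
      (hU.isInternal_Iic star (star D) (star R) u)) (by
      intro s
      obtain ⟨e, he, -, hs⟩ := hD.exists_upper_bound hd₀ s
      have he' := (el_star_iff star).2 he
      -- Being limited, `δ` lies below a standard `f`, hence below the illimited `u`.
      obtain ⟨δ, ⟨hδ, f, hf, hδf⟩, heδ, hδA⟩ := h _ (hD.isLimited_star he)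
      refine ⟨δ, Set.mem_iInter.1 hδA.2, fun d hd => ⟨⟨hδ, ?_⟩, hδ, ?_⟩⟩
      · exact hD.rel_star_trans star ((el_star_iff star).2 d.2) he' hδ
          ((rel_star_iff star).2 (hs d hd)) heδ
      · exact hD.rel_star_trans star hδ ((el_star_iff star).2 hf) hu hδf (hDu f hf))
  have hx := (hxC ⟨d₀, hd₀⟩).1.1
  exact ⟨x, ⟨hx, fun d hd => (hxC ⟨d, hd⟩).1.2⟩, (hxC ⟨d₀, hd₀⟩).2.2, hx, Set.mem_iInter.2 hxA⟩

theorem not_containsAllLargeLimited_iff {G : Set M} :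
    ¬ ContainsAllLargeLimited star D R G ↔
      ContainsArbitrarilyLargeLimited star D R (starSet star D \ G) := by
  simp only [ContainsAllLargeLimited, ContainsArbitrarilyLargeLimited, Set.mem_sdiff]
  push Not
  exact forall₂_congr fun l _ => exists_congr fun δ =>
    ⟨fun h => ⟨h.1, h.2.1, h.1.1, h.2.2⟩, fun h => ⟨h.1, h.2.1, h.2.2.2⟩⟩

theorem not_containsArbitrarilyLargeLimited_iff {G : Set M} :
    ¬ ContainsArbitrarilyLargeLimited star D R G ↔
      ContainsAllLargeLimited star D R (starSet star D \ G) := by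
  simp only [ContainsAllLargeLimited, ContainsArbitrarilyLargeLimited, Set.mem_sdiff]
  push Not
  exact exists_congr fun l => and_congr_right fun _ => forall₂_congr fun δ hδ =>
    imp_congr_right fun _ => (and_iff_right hδ.1).symm

theorem not_containsAllSmallIllimited_iff {G : Set M} :
    ¬ ContainsAllSmallIllimited star D R G ↔
      ContainsArbitrarilySmallIllimited star D R (starSet star D \ G) := by
  simp only [ContainsAllSmallIllimited, ContainsArbitrarilySmallIllimited, Set.mem_sdiff]
  push Not
  exact forall₂_congr fun l _ => exists_congr fun δ =>
    ⟨fun h => ⟨h.1, h.2.1, h.1.1, h.2.2⟩, fun h => ⟨h.1, h.2.1, h.2.2.2⟩⟩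

theorem not_containsArbitrarilySmallIllimited_iff {G : Set M} :
    ¬ ContainsArbitrarilySmallIllimited star D R G ↔
      ContainsAllSmallIllimited star D R (starSet star D \ G) := by
  simp only [ContainsAllSmallIllimited, ContainsArbitrarilySmallIllimited, Set.mem_sdiff]
  push Not
  exact exists_congr fun l => and_congr_right fun _ => forall₂_congr fun δ hδ =>
    imp_congr_right fun _ => (and_iff_right hδ.1).symm

/-- The outer factor `starSet star D` keeps this valid for an empty family, whose intersection is
all of `M`. -/
theorem starSet_diff_iUnion {ι : Type*} (A : ι → Set M) :
    starSet star D \ ⋃ i, A i = starSet star D ∩ ⋂ i, starSet star D \ A i := by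
  ext x
  simp only [Set.mem_sdiff, Set.mem_iUnion, not_exists, Set.mem_inter_iff, Set.mem_iInter]
  exact and_congr_right fun hx => forall_congr' fun _ => (and_iff_right hx).symm

end Overspill

end Nonstandard

theorem mainTheorem6 {U M : Type*}
    [Nonstandard.setLang.Structure U] [Nonstandard.setLang.Structure M]
    (hU : Nonstandard.IsStandardUniverse U)
    (star : FirstOrder.Language.ElementaryEmbedding Nonstandard.setLang U M)
    (hsat : Nonstandard.IsSaturated U M)
    (D R : U) (hD : Nonstandard.IsDirectedSet D R) :
    (∀ H : Set M, H ⊆ Nonstandard.starSet star D → Nonstandard.IsHalic U H →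
      (Nonstandard.ContainsAllLargeLimited star D R H →
        Nonstandard.ContainsAllSmallIllimited star D R H) ∧
      (Nonstandard.ContainsArbitrarilyLargeLimited star D R H →
        Nonstandard.ContainsArbitrarilySmallIllimited star D R H)) ∧
    (∀ G : Set M, G ⊆ Nonstandard.starSet star D → Nonstandard.IsGalactic U G →
      (Nonstandard.ContainsAllSmallIllimited star D R G →
        Nonstandard.ContainsAllLargeLimited star D R G) ∧
      (Nonstandard.ContainsArbitrarilySmallIllimited star D R G →
        Nonstandard.ContainsArbitrarilyLargeLimited star D R G)) := by
  have hint : Nonstandard.IsInternal (Nonstandard.starSet star D) := ⟨star D, rfl⟩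
  refine ⟨fun H hH hhal => ?_, fun G _ hgal => ?_⟩
  · obtain ⟨S, A, hA, rfl⟩ := hhal
    rw [← Set.inter_eq_right.2 hH]
    exact ⟨Nonstandard.containsAllSmallIllimited_of_halic hU hsat hD hA,
      Nonstandard.containsArbitrarilySmallIllimited_of_halic hU hsat hD hA⟩
  · obtain ⟨S, A, hA, rfl⟩ := hgal
    have hA' := fun i => hU.isInternal_diff star hint (hA i)
    constructor
    -- Each part of underspill for `G` is the other part of overspill for its complement in `*D`.
    · contrapose
      rw [Nonstandard.not_containsAllLargeLimited_iff,
        Nonstandard.not_containsAllSmallIllimited_iff, Nonstandard.starSet_diff_iUnion]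
      exact Nonstandard.containsArbitrarilySmallIllimited_of_halic hU hsat hD hA'
    · contrapose
      rw [Nonstandard.not_containsArbitrarilyLargeLimited_iff,
        Nonstandard.not_containsArbitrarilySmallIllimited_iff, Nonstandard.starSet_diff_iUnion]
      exact Nonstandard.containsAllSmallIllimited_of_halic hU hsat hD hA'
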